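/- Let $\mathcal Z$ be a finite set with $|\mathcal Z|=N\ge 2$. A set $\mathcal D$ of transition (row-stochastic) matrices on a finite set $S$ has *separately specified rows* (SSR) if every matrix, each of whose rows is the corresponding row of some member of $\mathcal D$, belongs to $\mathcal D$. The *imprecise Markov chain* of $\mathcal D$ is the set $\mathcal P_{\mathcal D}$ of all homogeneous Markov chains $(Z_n)_{n\ge0}$ on $S$ with transition matrix in $\mathcal D$; put $\overline{\mathbb E}_{\mathcal D}[f\mid Z_0=z]=\sup_{\mathbb P\in\mathcal P_{\mathcal D}}\mathbb E_{\mathbb P}[f\mid Z_0=z]$, $\underline{\mathbb E}_{\mathcal D}[f\mid Z_0=z]=\inf_{\mathbb P\in\mathcal P_{\mathcal D}}\mathbb E_{\mathbb P}[f\mid Z_0=z]$ (over those $\mathbb P$ with $\mathbb P(Z_0=z)>0$). For $A\subseteq S$ let $\tau_A=\inf\{n\ge 0: Z_n\in A\}\in\mathbb N_0\cup\{+\infty\}$, $\overline h^{\mathcal D}_A(z)=\overline{\mathbb E}_{\mathcal D}[\tau_A\mid Z_0=z]$ and $\underline h^{\mathcal D}_A(z)=\underline{\mathbb E}_{\mathcal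 D}[\tau_A\mid Z_0=z]$. For $f:S\to[0,+\infty]$ let $[\overline{\Delta}_{\mathcal D}f](z)=\sup_{\Delta\in\mathcal D}\sum_{z'}\Delta(z,z')f(z')$ and $[\underline{\Delta}_{\mathcal D}f](z)=\inf_{\Delta\in\mathcal D}\sum_{z'}\Delta(z,z')f(z')$, with $0\cdot\infty=0$. Let $\mathcal T$ be a non-empty compact set of transition matrices on $\mathcal Z$ with SSR. **Two agents.** Let $\mathcal T^2$ be the set of all matrices $\Delta\bigl((x,y),(x',y')\bigr)=T^y(x,x')\,S^x(y,y')$ on $\mathcal Z\times\mathcal Z$, where $(T^y)_{y\in\mathcal Z}$ and $(S^x)_{x\in\mathcal Z}$ range over all families in $\mathcal T$. Let $D=\{(k,k):k\in\mathcal Z\}$, let $\mu=\inf\{n\ge 0:X_n=Y_n\}$ be the meeting time, and for $\mathcal D=\mathcal T^2$ or its convex hull $\mathrm{ch}(\mathcal T^2)$ let $\overline m^{\mathcal D}(x,y)=\overline{\mathbb E}_{\mathcal D}[\mu\mid (X_0,Y_0)=(x,y)]$ and $\underline m^{\mathcal D}(x,y)=\underline{\mathbb E}_{\mathcal D}[\mu\mid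 (X_0,Y_0)=(x,y)]$. Then: 1. $\mathcal T^2$ is a compact set of transition matrices on $\mathcal Z\times\mathcal Z$ with SSR. 2. $\overline m^{\mathcal T^2}=\overline h^{\mathcal T^2}_D$ and $\overline m^{\mathrm{ch}(\mathcal T^2)}=\overline m^{\mathcal T^2}$. 3. $\overline m^{\mathcal T^2}$ is the (pointwise) minimal $[0,+\infty]$-valued solution of $m=\mathbb 1_{D^c}+\mathbb 1_{D^c}\cdot\overline{\Delta}\,m$, where $\overline\Delta=\overline\Delta_{\mathrm{ch}(\mathcal T^2)}$. 4. Likewise, $\underline m^{\mathcal T^2}=\underline h^{\mathcal T^2}_D$, $\underline m^{\mathrm{ch}(\mathcal T^2)}=\underline m^{\mathcal T^2}$, and $\underline m^{\mathcal T^2}$ is the minimal $[0,+\infty]$-valued solution of $m=\mathbb 1_{D^c}+\mathbb 1_{D^c}\cdot\underline{\Delta}\,m$, where $\underline\Delta=\underline\Delta_{\mathrm{ch}(\mathcal T^2)}$. **$m$ agents.** The same statements hold for every $m\ge2$ on $\mathcal Z^m$, with $\mathcal T^2$ replaced by the set $\mathcal T^m$ of all matrices $\Delta_m(z,z')=\prod_{j=1}^m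 T_j^{(z_i)_{i\ne j}}(z_j,z'_j)$, where all $T_j^{w}$ ($1\le j\le m$, $w\in\mathcal Z^{m-1}$) range over $\mathcal T$, with $D$ replaced by $\{(k,\dots,k):k\in\mathcal Z\}$, and with $\mu$ replaced by the first time at which all $m$ agents are in the same state. **Non-convexity.** Convexity does not carry over in general: on every $\mathcal Z$ with $|\mathcal Z|\ge 2$ there is a non-empty compact convex set $\mathcal T$ of transition matrices with SSR such that $\mathcal T^2$, and $\mathcal T^m$ for every $m\ge 2$, is not convex. -/

import Mathlib

open MeasureTheory ProbabilityTheory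
open scoped ENNReal

noncomputable section

namespace MeetingTimes

section General

variable {S : Type*} [Fintype S]

/-- A set of matrices has separately specified rows: a matrix each of whose rows is the
corresponding row of some member of the set is itself a member of the set. -/
def HasSSR (D : Set (Matrix S S ℝ)) : Prop :=
  ∀ T : Matrix S S ℝ, (∀ z, ∃ U ∈ D, U z = T z) → T ∈ D

/-- `P` is the law, on the path space `ℕ → S`, of a homogeneous Markov chain with transition
matrix `T` (and arbitrary initial distribution):
`P(Z₀ = z₀, …, Zₙ₊₁ = zₙ₊₁) = P(Z₀ = z₀, …, Zₙ = zₙ) T(zₙ, zₙ₊₁)`, which says that the conditional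
probability of `Zₙ₊₁ = zₙ₊₁` given `Z₀ = z₀, …, Zₙ = zₙ` is `T(zₙ, zₙ₊₁)` whenever it is defined. -/
structure IsHomogeneousMarkovChain [MeasurableSpace S] (T : Matrix S S ℝ)
    (P : Measure (ℕ → S)) : Prop where
  isProbabilityMeasure : IsProbabilityMeasure P
  step : ∀ (n : ℕ) (z : ℕ → S),
    P {ω | ∀ i ≤ n + 1, ω i = z i} =
      P {ω | ∀ i ≤ n, ω i = z i} * ENNReal.ofReal (T (z n) (z (n + 1)))

/-- The imprecise Markov chain of a set `D` of transition matrices: all (laws of) homogeneous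
Markov chains whose transition matrix belongs to `D`. -/
def impreciseMarkovChain [MeasurableSpace S] (D : Set (Matrix S S ℝ)) : Set (Measure (ℕ → S)) :=
  {P | ∃ T ∈ D, IsHomogeneousMarkovChain T P}

/-- The conditional expectation `E_P[f | Z₀ = z]` of a `[0, ∞]`-valued function of the path. -/
def expectationFrom [MeasurableSpace S] (P : Measure (ℕ → S)) (f : (ℕ → S) → ℝ≥0∞) (z : S) :
    ℝ≥0∞ :=
  ∫⁻ ω, f ω ∂(P[|{ω : ℕ → S | ω 0 = z}])

/-- Upper expectation of `f` given `Z₀ = z`: supremum over all chains of the imprecise Markov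
chain for which the conditioning event has positive probability. -/
def upperExpectation [MeasurableSpace S] (D : Set (Matrix S S ℝ)) (f : (ℕ → S) → ℝ≥0∞) (z : S) :
    ℝ≥0∞ :=
  ⨆ P ∈ impreciseMarkovChain D, ⨆ _ : P {ω | ω 0 = z} ≠ 0, expectationFrom P f z

/-- Lower expectation of `f` given `Z₀ = z`. -/
def lowerExpectation [MeasurableSpace S] (D : Set (Matrix S S ℝ)) (f : (ℕ → S) → ℝ≥0∞) (z : S) :
    ℝ≥0∞ :=
  ⨅ P ∈ impreciseMarkovChain D, ⨅ _ : P {ω | ω 0 = z} ≠ 0, expectationFrom P f z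

/-- The hitting time `inf {n ≥ 0 : Zₙ ∈ A}`, equal to `∞` if the path never visits `A`. -/
def hittingTime (A : Set S) (ω : ℕ → S) : ℝ≥0∞ :=
  ⨅ (n : ℕ) (_ : ω n ∈ A), (n : ℝ≥0∞)

/-- Upper expected hitting time of `A`. -/
def upperHitting [MeasurableSpace S] (D : Set (Matrix S S ℝ)) (A : Set S) : S → ℝ≥0∞ :=
  upperExpectation D (hittingTime A)

/-- Lower expected hitting time of `A`. -/
def lowerHitting [MeasurableSpace S] (D : Set (Matrix S S ℝ)) (A : Set S) : S → ℝ≥0∞ :=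
  lowerExpectation D (hittingTime A)

/-- Upper transition operator `f ↦ (z ↦ sup_{T ∈ D} ∑_{z'} T(z, z') f(z'))`, on `[0, ∞]`-valued
functions since expected hitting times may be infinite (with `0 * ∞ = 0`). -/
def upperTransition (D : Set (Matrix S S ℝ)) (f : S → ℝ≥0∞) (z : S) : ℝ≥0∞ :=
  ⨆ T ∈ D, ∑ z', ENNReal.ofReal (T z z') * f z'

/-- Lower transition operator. -/
def lowerTransition (D : Set (Matrix S S ℝ)) (f : S → ℝ≥0∞) (z : S) : ℝ≥0∞ :=
  ⨅ T ∈ D, ∑ z', ENNReal.ofReal (T z z') * f z'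

/-- `h` is the (pointwise) minimal solution with values in `[0, ∞]` of the equation
`h = 1_{Aᶜ} + 1_{Aᶜ} · Q h`. -/
def IsMinimalSolution (A : Set S) (Q : (S → ℝ≥0∞) → S → ℝ≥0∞) (h : S → ℝ≥0∞) : Prop :=
  IsLeast {f : S → ℝ≥0∞ | f = Aᶜ.indicator 1 + Aᶜ.indicator 1 * Q f} h

end General

section TwoAgents

variable {Z : Type*} [Fintype Z]

/-- The joint matrix `((x, y), (x', y')) ↦ T^y(x, x') S^x(y, y')` of selections `(T^y)`, `(S^x)`. -/
def jointMatrix₂ (T S : Z → Matrix Z Z ℝ) : Matrix (Z × Z) (Z × Z) ℝ :=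
  Matrix.of fun p q => T p.2 p.1 q.1 * S p.1 p.2 q.2

/-- The set `𝒯²` of all joint matrices of two interdependent agents with selections in `𝒯`. -/
def jointSet₂ (𝒯 : Set (Matrix Z Z ℝ)) : Set (Matrix (Z × Z) (Z × Z) ℝ) :=
  {Δ | ∃ T S : Z → Matrix Z Z ℝ, (∀ y, T y ∈ 𝒯) ∧ (∀ x, S x ∈ 𝒯) ∧ Δ = jointMatrix₂ T S}

/-- The meeting time `inf {n ≥ 0 : Xₙ = Yₙ}`. -/
def meetingTime₂ (ω : ℕ → Z × Z) : ℝ≥0∞ :=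
  ⨅ (n : ℕ) (_ : (ω n).1 = (ω n).2), (n : ℝ≥0∞)

/-- Upper expected meeting time over a set `D` of transition matrices on `Z × Z`. -/
def upperMeeting₂ [MeasurableSpace Z] (D : Set (Matrix (Z × Z) (Z × Z) ℝ)) : Z × Z → ℝ≥0∞ :=
  upperExpectation D meetingTime₂

/-- Lower expected meeting time over a set `D` of transition matrices on `Z × Z`. -/
def lowerMeeting₂ [MeasurableSpace Z] (D : Set (Matrix (Z × Z) (Z × Z) ℝ)) : Z × Z → ℝ≥0∞ :=
  lowerExpectation D meetingTime₂

end TwoAgents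

section ManyAgents

variable {Z : Type*} [Fintype Z] {m : ℕ}

/-- The joint matrix `(z, z') ↦ ∏ⱼ Tⱼ^{(zᵢ)_{i ≠ j}}(zⱼ, z'ⱼ)` of a family of selections. -/
def jointMatrix (T : (j : Fin m) → ({i : Fin m // i ≠ j} → Z) → Matrix Z Z ℝ) :
    Matrix (Fin m → Z) (Fin m → Z) ℝ :=
  Matrix.of fun z z' => ∏ j, T j (fun i => z i) (z j) (z' j)

/-- The set `𝒯ᵐ` of all joint matrices of `m` interdependent agents with selections in `𝒯`. -/
def jointSet (m : ℕ) (𝒯 : Set (Matrix Z Z ℝ)) : Set (Matrix (Fin m → Z) (Fin m → Z) ℝ) :=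
  {Δ | ∃ T : (j : Fin m) → ({i : Fin m // i ≠ j} → Z) → Matrix Z Z ℝ,
    (∀ j w, T j w ∈ 𝒯) ∧ Δ = jointMatrix T}

/-- The diagonal `{(k, …, k) : k ∈ Z}` of `Zᵐ`. -/
def multiDiagonal (m : ℕ) (Z : Type*) : Set (Fin m → Z) :=
  {z | ∃ k : Z, z = fun _ => k}

/-- The meeting time of `m` agents: the first time at which all of them are in the same state. -/
def meetingTime (ω : ℕ → Fin m → Z) : ℝ≥0∞ :=
  ⨅ (n : ℕ) (_ : ∀ i j, ω n i = ω n j), (n : ℝ≥0∞)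

/-- Upper expected meeting time over a set `D` of transition matrices on `Zᵐ`. -/
def upperMeeting [MeasurableSpace Z] (D : Set (Matrix (Fin m → Z) (Fin m → Z) ℝ)) :
    (Fin m → Z) → ℝ≥0∞ :=
  upperExpectation D meetingTime

/-- Lower expected meeting time over a set `D` of transition matrices on `Zᵐ`. -/
def lowerMeeting [MeasurableSpace Z] (D : Set (Matrix (Fin m → Z) (Fin m → Z) ℝ)) :
    (Fin m → Z) → ℝ≥0∞ :=
  lowerExpectation D meetingTime

end ManyAgents

end MeetingTimes

end

noncomputable section

namespace MeetingTimes

/-! ### Hitting times of a single Markov chain. -/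

section HittingTimes

/-! Meeting is hitting the diagonal, so everything reduces to hitting times over a non-empty compact
set `D` of stochastic matrices with SSR. For one matrix, `τ = ∑ₙ 1_{τ > n}` and the Markov property
identify the expected hitting time with the least fixed point of `f ↦ 1_{Aᶜ} (1 + T f)`. Comparing
least fixed points, each chain lies below that of the upper operator and above that of the lower
one.

Equality needs one matrix that is optimal in every row at once; compactness and SSR provide it. For
the lower operator, a minimiser at its least solution exists even when infinite values occur, and
that solution is a supersolution for the minimiser. For the upper operator, a maximiser may fail to
exist at infinite values, and a subsolution for one matrix need not lie below its least solution.
Discounting by `β < 1` cures both: solutions become bounded and the map a contraction. The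
discounted solutions then increase to a supersolution as `β` tends to `1`
(`leastSolution_upperTransition_le`).

The hull has the same transition operators, since these optimise a function affine in `T`. The
one-sided bounds need neither compactness nor SSR, so they squeeze the hitting times of the hull.

The joint set inherits compactness as a continuous image and SSR because each row of each selected
matrix enters just one joint row. Convexity is lost because a mixture of product measures need not
be a product. -/

theorem hittingTime_eq_tsum {S : Type*} (A : Set S) (ω : ℕ → S) :
    hittingTime A ω = ∑' n : ℕ, {ω : ℕ → S | ∀ i ≤ n, ω i ∉ A}.indicator 1 ω := by
  classical
  by_cases h : ∃ n, ω n ∈ A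
  · have hN := Nat.find_spec h
    have hmin : ∀ i, i < Nat.find h → ω i ∉ A := fun i hi => Nat.find_min h hi
    set N := Nat.find h
    have h1 : hittingTime A ω = N := by
      refine le_antisymm (iInf₂_le N hN) (le_iInf₂ fun n hn => ?_)
      by_contra hlt
      exact hmin n (by exact_mod_cast not_le.1 hlt) hn
    have h2 : ∀ n ∉ Finset.range N,
        {ω : ℕ → S | ∀ i ≤ n, ω i ∉ A}.indicator (1 : (ℕ → S) → ℝ≥0∞) ω = 0 := by
      intro n hn
      refine Set.indicator_of_notMem ?_ _
      rw [Set.mem_ofPred_eq]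
      exact fun hω => hω N (by simpa using hn) hN
    have h3 : ∀ n ∈ Finset.range N,
        {ω : ℕ → S | ∀ i ≤ n, ω i ∉ A}.indicator (1 : (ℕ → S) → ℝ≥0∞) ω = 1 := by
      intro n hn
      refine Set.indicator_of_mem (s := {ω : ℕ → S | ∀ i ≤ n, ω i ∉ A}) (fun i hi => ?_) _
      exact hmin i (lt_of_le_of_lt hi (Finset.mem_range.1 hn))
    rw [h1, tsum_eq_sum h2, Finset.sum_congr rfl h3]
    simp
  · push Not at h
    have h1 : hittingTime A ω = ∞ := by simp [hittingTime, h]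
    have h2 : ∀ n, {ω : ℕ → S | ∀ i ≤ n, ω i ∉ A}.indicator (1 : (ℕ → S) → ℝ≥0∞) ω = 1 :=
      fun n => Set.indicator_of_mem (s := {ω : ℕ → S | ∀ i ≤ n, ω i ∉ A}) (fun i _ => h i) _
    rw [h1, tsum_congr h2, ENNReal.tsum_const_eq_top_of_ne_zero one_ne_zero]

theorem measurableSet_eval_mem {S : Type*} [MeasurableSpace S] (i : ℕ) {B : Set S}
    (hB : MeasurableSet B) : MeasurableSet {ω : ℕ → S | ω i ∈ B} := by
  have h : MeasurableSet ((fun ω : ℕ → S => ω i) ⁻¹' B) := measurable_pi_apply i hB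
  exact h

theorem measurableSet_cylinder {S : Type*} [MeasurableSpace S] [MeasurableSingletonClass S]
    (n : ℕ) (z : ℕ → S) : MeasurableSet {ω : ℕ → S | ∀ i ≤ n, ω i = z i} := by
  simp only [Set.ofPred_forall]
  exact MeasurableSet.iInter fun i => MeasurableSet.iInter fun _ =>
    measurableSet_eval_mem i (measurableSet_singleton (z i))

variable {S : Type*} [Fintype S]

/-- The probability that a chain with transition matrix `T` started in `z` avoids `A` during the
times `0, …, k`. -/
def avoidProb (T : Matrix S S ℝ) (A : Set S) : ℕ → S → ℝ≥0∞
  | 0, z => Aᶜ.indicator 1 z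
  | k + 1, z => Aᶜ.indicator 1 z * ∑ z', ENNReal.ofReal (T z z') * avoidProb T A k z'

/-- The expected hitting time of `A` for a chain with transition matrix `T`. -/
def expectedHitting (T : Matrix S S ℝ) (A : Set S) (z : S) : ℝ≥0∞ :=
  ∑' k, avoidProb T A k z

variable [MeasurableSpace S]

/-- The probability measure on `S` given by the row `z` of the matrix `T`. -/
def rowMeasure (T : Matrix S S ℝ) (z : S) : Measure S :=
  ∑ z', ENNReal.ofReal (T z z') • Measure.dirac z'

theorem isProbabilityMeasure_rowMeasure [DecidableEq S] {T : Matrix S S ℝ}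
    (hT : T ∈ Matrix.rowStochastic ℝ S) (z : S) : IsProbabilityMeasure (rowMeasure T z) := by
  constructor
  simp only [rowMeasure, Measure.coe_finsetSum, Measure.coe_smul, Finset.sum_apply, Pi.smul_apply,
    measure_univ, smul_eq_mul, mul_one]
  rw [← ENNReal.ofReal_sum_of_nonneg fun i _ => Matrix.nonneg_of_mem_rowStochastic hT,
    Matrix.sum_row_of_mem_rowStochastic hT, ENNReal.ofReal_one]

variable [MeasurableSingletonClass S]

theorem rowMeasure_singleton (T : Matrix S S ℝ) (z z' : S) :
    rowMeasure T z {z'} = ENNReal.ofReal (T z z') := by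
  classical
  simp [rowMeasure, Set.indicator_apply]

theorem measurableSet_avoid (A : Set S) (n : ℕ) :
    MeasurableSet {ω : ℕ → S | ∀ i ≤ n, ω i ∉ A} := by
  simp only [Set.ofPred_forall]
  exact MeasurableSet.iInter fun i => MeasurableSet.iInter fun _ =>
    measurableSet_eval_mem i (Set.toFinite Aᶜ).measurableSet

/-- The Markov property in product form, which avoids conditioning on null cylinders. The induction
on `k` needs all `n` and `z`, because splitting on the next state lengthens the cylinder. -/
theorem IsHomogeneousMarkovChain.measure_cylinder_inter_avoid {T : Matrix S S ℝ}
    {P : Measure (ℕ → S)} (hP : IsHomogeneousMarkovChain T P) (A : Set S) (k : ℕ) :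
    ∀ (n : ℕ) (z : ℕ → S),
      P ({ω | ∀ i ≤ n, ω i = z i} ∩ {ω | ∀ j ≤ k, ω (n + j) ∉ A}) =
        P {ω | ∀ i ≤ n, ω i = z i} * avoidProb T A k (z n) := by
  classical
  induction k with
  | zero =>
    intro n z
    by_cases hz : z n ∈ A
    · have : {ω : ℕ → S | ∀ i ≤ n, ω i = z i} ∩ {ω | ∀ j ≤ 0, ω (n + j) ∉ A} = ∅ := by
        ext ω
        simp only [Set.mem_inter_iff, Set.mem_ofPred_eq, Set.mem_empty_iff_false, iff_false, not_and]
        intro h1 h2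
        exact h2 0 le_rfl (by rw [Nat.add_zero, h1 n le_rfl]; exact hz)
      rw [this]
      simp [avoidProb, hz]
    · have : {ω : ℕ → S | ∀ i ≤ n, ω i = z i} ∩ {ω | ∀ j ≤ 0, ω (n + j) ∉ A} =
          {ω | ∀ i ≤ n, ω i = z i} := by
        refine Set.inter_eq_left.2 fun ω h1 j hj => ?_
        rw [Nat.le_zero.1 hj, Nat.add_zero, h1 n le_rfl]
        exact hz
      rw [this]
      simp [avoidProb, hz]
  | succ k ih =>
    intro n z
    by_cases hz : z n ∈ A
    · have : {ω : ℕ → S | ∀ i ≤ n, ω i = z i} ∩ {ω | ∀ j ≤ k + 1, ω (n + j) ∉ A} = ∅ := by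
        ext ω
        simp only [Set.mem_inter_iff, Set.mem_ofPred_eq, Set.mem_empty_iff_false, iff_false, not_and]
        intro h1 h2
        exact h2 0 (Nat.zero_le _) (by rw [Nat.add_zero, h1 n le_rfl]; exact hz)
      rw [this]
      simp [avoidProb, hz]
    -- `w s` prescribes the next state `s`; the cylinders of the `w s` partition that of `z`.
    · let w : S → ℕ → S := fun s => Function.update z (n + 1) s
      have hw : ∀ s, ∀ i ≤ n, w s i = z i := fun s i hi =>
        Function.update_of_ne (by omega) _ _
      have hw' : ∀ s, w s (n + 1) = s := fun s => Function.update_self _ _ _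
      have hcyl : ∀ s, {ω : ℕ → S | ∀ i ≤ n, ω i = w s i} = {ω | ∀ i ≤ n, ω i = z i} := by
        intro s
        ext ω
        exact forall₂_congr fun i hi => by rw [hw s i hi]
      have hunion : {ω : ℕ → S | ∀ i ≤ n, ω i = z i} ∩ {ω | ∀ j ≤ k + 1, ω (n + j) ∉ A} =
          ⋃ s, ({ω : ℕ → S | ∀ i ≤ n + 1, ω i = w s i} ∩
            {ω | ∀ j ≤ k, ω (n + 1 + j) ∉ A}) := by
        ext ω
        simp only [Set.mem_inter_iff, Set.mem_ofPred_eq, Set.mem_iUnion]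
        constructor
        · rintro ⟨h1, h2⟩
          refine ⟨ω (n + 1), fun i hi => ?_, fun j hj => ?_⟩
          · rcases Nat.le_succ_iff.1 hi with hi | rfl
            · rw [hw _ i hi, h1 i hi]
            · rw [hw']
          · have := h2 (j + 1) (by omega)
            rwa [show n + 1 + j = n + (j + 1) by omega]
        · rintro ⟨s, h1, h2⟩
          have h3 : ∀ i ≤ n, ω i = z i := fun i hi => by rw [h1 i (by omega), hw s i hi]
          refine ⟨h3, fun j hj => ?_⟩
          rcases j with _ | j
          · rw [Nat.add_zero, h3 n le_rfl]
            exact hz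
          · have := h2 j (by omega)
            rwa [show n + 1 + j = n + (j + 1) by omega] at this
      rw [hunion, measure_iUnion]
      · simp only [tsum_fintype, ih, hP.step, hcyl, hw', hw _ n le_rfl, avoidProb,
          Set.indicator_of_mem (Set.mem_compl hz), Pi.one_apply, one_mul, Finset.mul_sum, mul_assoc]
      · intro s t hst
        refine Set.disjoint_left.2 fun ω h1 h2 => hst ?_
        rw [← hw' s, ← hw' t, ← h1.1 (n + 1) le_rfl, h2.1 (n + 1) le_rfl]
      · intro s
        refine (measurableSet_cylinder _ _).inter ?_
        simp only [Set.ofPred_forall]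
        exact MeasurableSet.iInter fun i => MeasurableSet.iInter fun _ =>
          measurableSet_eval_mem _ (Set.toFinite Aᶜ).measurableSet

theorem IsHomogeneousMarkovChain.expectationFrom_hittingTime {T : Matrix S S ℝ}
    {P : Measure (ℕ → S)} (hP : IsHomogeneousMarkovChain T P) (A : Set S) {z : S}
    (hz : P {ω | ω 0 = z} ≠ 0) :
    expectationFrom P (hittingTime A) z = expectedHitting T A z := by
  have := hP.isProbabilityMeasure
  have hmeas : MeasurableSet {ω : ℕ → S | ω 0 = z} :=
    measurableSet_eval_mem 0 (measurableSet_singleton z)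
  have key : ∀ k, P ({ω | ω 0 = z} ∩ {ω | ∀ j ≤ k, ω j ∉ A}) =
      P {ω | ω 0 = z} * avoidProb T A k z := by
    intro k
    simpa using hP.measure_cylinder_inter_avoid A k 0 (fun _ => z)
  simp only [expectationFrom, expectedHitting, hittingTime_eq_tsum]
  rw [lintegral_tsum fun n => (measurable_one.indicator (measurableSet_avoid A n)).aemeasurable]
  refine tsum_congr fun k => ?_
  rw [lintegral_indicator_one (measurableSet_avoid A k), cond_apply hmeas, key, ← mul_assoc,
    ENNReal.inv_mul_cancel hz (measure_ne_top _ _), one_mul]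

/-- The Ionescu-Tulcea construction started from a point mass at `z`. It ensures that every matrix
of `D` contributes to the upper and lower expectations at every state. -/
theorem exists_isHomogeneousMarkovChain [DecidableEq S] {T : Matrix S S ℝ}
    (hT : T ∈ Matrix.rowStochastic ℝ S) (z : S) :
    ∃ P : Measure (ℕ → S), IsHomogeneousMarkovChain T P ∧ P {ω | ω 0 = z} ≠ 0 := by
  let κ : (n : ℕ) → Kernel ((i : Finset.Iic n) → S) S := fun n =>
    ⟨fun x => rowMeasure T (x ⟨n, Finset.mem_Iic.2 le_rfl⟩), Measurable.of_discrete⟩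
  have hκ : ∀ n, IsMarkovKernel (κ n) := fun n =>
    ⟨fun x => isProbabilityMeasure_rowMeasure hT _⟩
  let P : Measure (ℕ → S) := Kernel.trajMeasure (X := fun _ => S) (Measure.dirac z) κ
  have hprob : IsProbabilityMeasure P :=
    inferInstanceAs (IsProbabilityMeasure
      (Kernel.trajMeasure (X := fun _ => S) (Measure.dirac z) κ))
  refine ⟨P, ⟨hprob, fun n w => ?_⟩, ?_⟩
  · have h := Kernel.map_frestrictLe_trajMeasure_compProd_eq_map_trajMeasure
      (X := fun _ => S) (μ₀ := Measure.dirac z) (κ := κ) (a := n)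
    -- Evaluating the identity between the law of the history up to `n + 1` and the composition
    -- product on a one-point rectangle gives the step equation.
    let w' : (i : Finset.Iic n) → S := fun i => w i
    have h' := DFunLike.congr_fun h ({w'} ×ˢ {w (n + 1)})
    have hm : Measurable (Preorder.frestrictLe (π := fun _ : ℕ => S) n) := by fun_prop
    rw [Measure.compProd_apply_prod (measurableSet_singleton _) (measurableSet_singleton _),
      Measure.map_apply (by fun_prop)
        ((measurableSet_singleton _).prod (measurableSet_singleton _)),
      lintegral_singleton, Measure.map_apply hm (measurableSet_singleton _)] at h'
    have e1 : Preorder.frestrictLe (π := fun _ : ℕ => S) n ⁻¹' {w'} =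
        {ω | ∀ i ≤ n, ω i = w i} := by
      ext ω
      simp [w', funext_iff, Preorder.frestrictLe]
    have e2 : (fun x : ℕ → S => (Preorder.frestrictLe (π := fun _ : ℕ => S) n x, x (n + 1))) ⁻¹'
        ({w'} ×ˢ {w (n + 1)}) = {ω | ∀ i ≤ n + 1, ω i = w i} := by
      rw [Set.mk_preimage_prod, e1]
      ext ω
      constructor
      · rintro ⟨h1, h2⟩ i hi
        rcases Nat.le_succ_iff.1 hi with hi | rfl
        · exact h1 i hi
        · exact h2
      · exact fun h1 => ⟨fun i hi => h1 i (Nat.le_succ_of_le hi), h1 _ le_rfl⟩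
    rw [e1, e2] at h'
    have e3 : κ n w' {w (n + 1)} = ENNReal.ofReal (T (w n) (w (n + 1))) :=
      rowMeasure_singleton T _ _
    rw [e3] at h'
    rw [mul_comm]
    exact h'.symm
  · have hm : Measurable (Preorder.frestrictLe (π := fun _ : ℕ => S) 0) := by fun_prop
    let e := (MeasurableEquiv.piUnique (fun _ : Finset.Iic 0 => S)).symm
    have h1 : P.map (Preorder.frestrictLe (π := fun _ : ℕ => S) 0) = Measure.dirac (e z) := by
      have he : (Measure.dirac z).map e = Measure.dirac (e z) := Measure.map_dirac' e.measurable z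
      simp only [P, Kernel.trajMeasure]
      erw [he]
      rw [Measure.map_comp _ _ hm, Kernel.traj_map_frestrictLe, Kernel.partialTraj_self]
      exact Measure.id_comp
    have h2 := congrArg (fun μ => μ {e z}) h1
    simp only [Measure.map_apply hm (measurableSet_singleton _), Measure.dirac_apply' _
      (measurableSet_singleton _)] at h2
    have h3 : {ω : ℕ → S | ω 0 = z} = Preorder.frestrictLe (π := fun _ : ℕ => S) 0 ⁻¹' {e z} := by
      ext ω
      constructor
      · intro h
        refine funext fun i => ?_
        rw [Unique.eq_default i]
        exact h
      · exact fun h => congrFun h default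
    rw [h3, h2]
    simp

end HittingTimes

/-! ### Least solutions of the hitting equation and optimal matrices. -/

section MinimalSolutions

variable {S : Type*} [Fintype S]

/-- The map `f ↦ 1_{Aᶜ} + β 1_{Aᶜ} · Q f`. -/
def hittingMap (β : ℝ≥0∞) (A : Set S) (Q : (S → ℝ≥0∞) → S → ℝ≥0∞) (f : S → ℝ≥0∞) : S → ℝ≥0∞ :=
  fun z => Aᶜ.indicator 1 z * (1 + β * Q f z)

/-- The transition operator of a single matrix. -/
def transition (T : Matrix S S ℝ) (f : S → ℝ≥0∞) (z : S) : ℝ≥0∞ :=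
  ∑ z', ENNReal.ofReal (T z z') * f z'

theorem transition_mono (T : Matrix S S ℝ) : Monotone (transition T) :=
  fun _ _ hfg _ => Finset.sum_le_sum fun z' _ => mul_le_mul_right (hfg z') _

theorem upperTransition_mono (D : Set (Matrix S S ℝ)) : Monotone (upperTransition D) :=
  fun _ _ hfg z => iSup₂_mono fun T _ => transition_mono T hfg z

theorem lowerTransition_mono (D : Set (Matrix S S ℝ)) : Monotone (lowerTransition D) :=
  fun _ _ hfg z => iInf₂_mono fun T _ => transition_mono T hfg z

theorem hittingMap_le_hittingMap {S : Type*} {β γ : ℝ≥0∞} (hβ : β ≤ γ) (A : Set S)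
    {Q R : (S → ℝ≥0∞) → S → ℝ≥0∞} {f g : S → ℝ≥0∞} {z : S} (h : Q f z ≤ R g z) :
    hittingMap β A Q f z ≤ hittingMap γ A R g z :=
  mul_le_mul_right (add_le_add le_rfl (mul_le_mul' hβ h)) _

theorem hittingMap_mono {S : Type*} (β : ℝ≥0∞) (A : Set S) {Q : (S → ℝ≥0∞) → S → ℝ≥0∞}
    (hQ : Monotone Q) : Monotone (hittingMap β A Q) :=
  fun _ _ hfg z => hittingMap_le_hittingMap le_rfl A (hQ hfg z)

/-- The least fixed point of `f ↦ 1_{Aᶜ} + β 1_{Aᶜ} · Q f` for a monotone operator `Q`. -/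
def leastSolution {S : Type*} (β : ℝ≥0∞) (A : Set S) {Q : (S → ℝ≥0∞) → S → ℝ≥0∞}
    (hQ : Monotone Q) : S → ℝ≥0∞ :=
  OrderHom.lfp ⟨hittingMap β A Q, hittingMap_mono β A hQ⟩

theorem hittingMap_leastSolution {S : Type*} (β : ℝ≥0∞) (A : Set S)
    {Q : (S → ℝ≥0∞) → S → ℝ≥0∞} (hQ : Monotone Q) :
    hittingMap β A Q (leastSolution β A hQ) = leastSolution β A hQ :=
  OrderHom.map_lfp ⟨hittingMap β A Q, hittingMap_mono β A hQ⟩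

theorem leastSolution_le {S : Type*} {β : ℝ≥0∞} {A : Set S} {Q : (S → ℝ≥0∞) → S → ℝ≥0∞}
    (hQ : Monotone Q) {f : S → ℝ≥0∞} (hf : hittingMap β A Q f ≤ f) : leastSolution β A hQ ≤ f :=
  OrderHom.lfp_le ⟨hittingMap β A Q, hittingMap_mono β A hQ⟩ hf

theorem leastSolution_congr {S : Type*} (β : ℝ≥0∞) (A : Set S) {Q R : (S → ℝ≥0∞) → S → ℝ≥0∞}
    {hQ : Monotone Q} {hR : Monotone R} (h : Q = R) : leastSolution β A hQ = leastSolution β A hR := by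
  subst h
  rfl

theorem isMinimalSolution_leastSolution {S : Type*} (A : Set S)
    {Q : (S → ℝ≥0∞) → S → ℝ≥0∞} (hQ : Monotone Q) :
    IsMinimalSolution A Q (leastSolution 1 A hQ) := by
  have h : ∀ f, Aᶜ.indicator 1 + Aᶜ.indicator 1 * Q f = hittingMap 1 A Q f := by
    intro f
    ext z
    simp [hittingMap, mul_add]
  simp only [IsMinimalSolution, h]
  exact ⟨(hittingMap_leastSolution 1 A hQ).symm, fun f hf => leastSolution_le hQ hf.ge⟩

/-- The partial sums of the avoidance probabilities are the iterates of the map from `0`, hence lie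
below every fixed point; their limit is itself a fixed point. -/
theorem expectedHitting_eq_leastSolution (T : Matrix S S ℝ) (A : Set S) :
    expectedHitting T A = leastSolution 1 A (transition_mono T) := by
  refine le_antisymm (fun z => ?_) (leastSolution_le _ (le_of_eq ?_))
  · refine ENNReal.tsum_le_of_sum_range_le fun n => ?_
    induction n generalizing z with
    | zero => simp
    | succ n ih =>
      rw [← hittingMap_leastSolution, Finset.sum_range_succ']
      simp only [avoidProb, hittingMap, ← Finset.mul_sum]
      rw [add_comm, mul_add, mul_one, one_mul, Finset.sum_comm]
      refine add_le_add le_rfl (mul_le_mul_right (Finset.sum_le_sum fun z' _ => ?_) _)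
      rw [← Finset.mul_sum]
      exact mul_le_mul_right (ih z') _
  · ext z
    rw [expectedHitting, tsum_eq_zero_add' ENNReal.summable]
    simp only [avoidProb, hittingMap, transition, expectedHitting, ENNReal.tsum_mul_left, mul_add,
      mul_one, one_mul]
    rw [Summable.tsum_finsetSum fun _ _ => ENNReal.summable]
    simp only [ENNReal.tsum_mul_left]

theorem transition_add_const [DecidableEq S] {T : Matrix S S ℝ}
    (hT : T ∈ Matrix.rowStochastic ℝ S) (f : S → ℝ≥0∞) (c : ℝ≥0∞) (z : S) :
    transition T (fun z => f z + c) z = transition T f z + c := by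
  simp only [transition, mul_add, Finset.sum_add_distrib, ← Finset.sum_mul]
  rw [← ENNReal.ofReal_sum_of_nonneg fun i _ => Matrix.nonneg_of_mem_rowStochastic hT,
    Matrix.sum_row_of_mem_rowStochastic hT, ENNReal.ofReal_one, one_mul]

/-- Two solutions of a discounted equation coincide if the larger one is bounded. -/
theorem le_leastSolution_of_discount [DecidableEq S] {T : Matrix S S ℝ}
    (hT : T ∈ Matrix.rowStochastic ℝ S) {β : ℝ≥0∞} (hβ : β < 1) (A : Set S) {f : S → ℝ≥0∞}
    {C : ℝ≥0∞} (hC : C ≠ ∞) (hfC : ∀ z, f z ≤ C) (hf : f ≤ hittingMap β A (transition T) f) :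
    f ≤ leastSolution β A (transition_mono T) := by
  set g := leastSolution β A (transition_mono T) with hg
  -- The largest excess of `f` over `g` is finite by the bound `C`, and one application of the map
  -- shrinks it by the factor `β`, so it is `0`.
  let δ : ℝ≥0∞ := ⨆ z, f z - g z
  have hδC : δ ≤ C := iSup_le fun z => tsub_le_self.trans (hfC z)
  have hfg : f ≤ fun z => g z + δ := fun z => tsub_le_iff_left.1 (le_iSup (fun z => f z - g z) z)
  have hδ : δ ≤ β * δ := by
    refine iSup_le fun z => tsub_le_iff_left.2 ?_
    calc f z ≤ hittingMap β A (transition T) f z := hf z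
      _ ≤ hittingMap β A (transition T) (fun z => g z + δ) z :=
        hittingMap_mono β A (transition_mono T) hfg z
      _ = hittingMap β A (transition T) g z + Aᶜ.indicator 1 z * (β * δ) := by
        simp only [hittingMap, transition_add_const hT, mul_add, add_assoc]
      _ ≤ g z + β * δ := by
        rw [hg, hittingMap_leastSolution]
        refine add_le_add le_rfl (mul_le_of_le_one_left zero_le ?_)
        exact Set.indicator_le_self' (fun _ _ => zero_le) z
  have h0 : δ = 0 := by
    by_contra h0
    have := ENNReal.mul_lt_mul_left h0 (ne_top_of_le_ne_top hC hδC) hβ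
    rw [one_mul] at this
    exact absurd hδ (not_le.2 this)
  intro z
  simpa [h0] using hfg z

/-- Where `f` is infinite, `T z z' * ∞` jumps from `0` to `∞` as the entry leaves `0`. Continuity
fails, but lower semicontinuity survives and suffices for minimisers. -/
theorem lowerSemicontinuous_transition (f : S → ℝ≥0∞) (z : S) :
    LowerSemicontinuous fun T : Matrix S S ℝ => transition T f z := by
  refine lowerSemicontinuous_sum fun z' _ => ?_
  have hc : Continuous fun T : Matrix S S ℝ => ENNReal.ofReal (T z z') :=
    ENNReal.continuous_ofReal.comp (continuous_apply_apply z z')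
  by_cases h : f z' = ∞
  · intro T y hy
    rw [h] at hy
    have h0 : ENNReal.ofReal (T z z') ≠ 0 := by
      rintro h0
      simp [h0] at hy
    filter_upwards [hc.continuousAt.eventually_ne h0] with U hU
    rw [h, ENNReal.mul_top hU]
    exact lt_of_lt_of_eq hy (ENNReal.mul_top h0)
  · exact ((ENNReal.continuous_mul_const h).comp hc).lowerSemicontinuous

theorem continuous_transition {f : S → ℝ≥0∞} (hf : ∀ z, f z ≠ ∞) (z : S) :
    Continuous fun T : Matrix S S ℝ => transition T f z :=
  continuous_finsetSum _ fun z' _ => (ENNReal.continuous_mul_const (hf z')).comp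
    (ENNReal.continuous_ofReal.comp (continuous_apply_apply z z'))

/-- With separately specified rows, row-wise selections can be combined. -/
theorem HasSSR.exists_forall {S : Type*} {D : Set (Matrix S S ℝ)} (hD : HasSSR D) {p : S → (S → ℝ) → Prop}
    (h : ∀ z, ∃ T ∈ D, p z (T z)) : ∃ T ∈ D, ∀ z, p z (T z) := by
  choose U hU hp using h
  exact ⟨Matrix.of fun z => U z z, hD _ fun z => ⟨U z, hU z, rfl⟩, hp⟩

theorem exists_transition_eq_lowerTransition {D : Set (Matrix S S ℝ)} (hne : D.Nonempty)
    (hc : IsCompact D) (hD : HasSSR D) (f : S → ℝ≥0∞) :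
    ∃ T ∈ D, transition T f = lowerTransition D f := by
  obtain ⟨T, hT, h⟩ := hD.exists_forall
    (p := fun z r => ∑ z', ENNReal.ofReal (r z') * f z' ≤ lowerTransition D f z) fun z => by
      obtain ⟨T, hT, hmin⟩ :=
        ((lowerSemicontinuous_transition f z).lowerSemicontinuousOn D).exists_isMinOn hne hc
      exact ⟨T, hT, le_iInf₂ fun U hU => hmin hU⟩
  exact ⟨T, hT, le_antisymm h fun z => iInf₂_le T hT⟩

theorem exists_transition_eq_upperTransition {D : Set (Matrix S S ℝ)} (hne : D.Nonempty)
    (hc : IsCompact D) (hD : HasSSR D) {f : S → ℝ≥0∞} (hf : ∀ z, f z ≠ ∞) :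
    ∃ T ∈ D, transition T f = upperTransition D f := by
  obtain ⟨T, hT, h⟩ := hD.exists_forall
    (p := fun z r => upperTransition D f z ≤ ∑ z', ENNReal.ofReal (r z') * f z') fun z => by
      obtain ⟨T, hT, hmax⟩ := hc.exists_isMaxOn hne (continuous_transition hf z).continuousOn
      exact ⟨T, hT, iSup₂_le fun U hU => hmax hU⟩
  exact ⟨T, hT, le_antisymm (fun z => le_iSup₂ (f := fun U _ => transition U f z) T hT) h⟩

/-- The vanishing-discount argument: each discounted solution is dominated by the hitting time of
its own maximising matrix, and the supremum over `β` is an undiscounted supersolution. -/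
theorem leastSolution_upperTransition_le [DecidableEq S] {D : Set (Matrix S S ℝ)}
    (hne : D.Nonempty) (hst : ∀ T ∈ D, T ∈ Matrix.rowStochastic ℝ S) (hc : IsCompact D)
    (hD : HasSSR D) (A : Set S) (z : S) :
    leastSolution 1 A (upperTransition_mono D) z ≤ ⨆ T ∈ D, expectedHitting T A z := by
  let H : Set.Iio (1 : ℝ≥0∞) → S → ℝ≥0∞ := fun β =>
    leastSolution (β : ℝ≥0∞) A (upperTransition_mono D)
  have hmono : Monotone H := by
    intro β γ h
    refine leastSolution_le _ ?_
    simp only [H]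
    conv_rhs => rw [← hittingMap_leastSolution]
    exact fun z => hittingMap_le_hittingMap h A le_rfl
  have hH : ∀ β z, H β z ≤ ⨆ T ∈ D, expectedHitting T A z := by
    intro β z
    have hβ : (β : ℝ≥0∞) < 1 := β.2
    have hC : (1 - (β : ℝ≥0∞))⁻¹ ≠ ∞ := by simpa [tsub_eq_zero_iff_le] using hβ
    -- The constant is the geometric sum, which solves `c = 1 + β c`; stochastic rows preserve
    -- constants.
    have hbound : ∀ z, H β z ≤ (1 - (β : ℝ≥0∞))⁻¹ := by
      refine leastSolution_le (f := fun _ => (1 - (β : ℝ≥0∞))⁻¹) _ fun z => ?_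
      have h1 : upperTransition D (fun _ => (1 - (β : ℝ≥0∞))⁻¹) z ≤ (1 - (β : ℝ≥0∞))⁻¹ := by
        refine iSup₂_le fun T hT => le_of_eq ?_
        have := transition_add_const (hst T hT) 0 (1 - (β : ℝ≥0∞))⁻¹ z
        simpa [transition] using this
      have h2 : 1 + (β : ℝ≥0∞) * (1 - (β : ℝ≥0∞))⁻¹ = (1 - (β : ℝ≥0∞))⁻¹ := by
        have h3 : (1 - (β : ℝ≥0∞)) * (1 - (β : ℝ≥0∞))⁻¹ = 1 :=
          ENNReal.mul_inv_cancel (tsub_pos_of_lt hβ).ne' (by simp)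
        nth_rw 1 [← h3]
        rw [← add_mul, tsub_add_cancel_of_le hβ.le, one_mul]
      calc hittingMap (β : ℝ≥0∞) A (upperTransition D) (fun _ => (1 - (β : ℝ≥0∞))⁻¹) z
          ≤ 1 * (1 + (β : ℝ≥0∞) * (1 - (β : ℝ≥0∞))⁻¹) :=
            mul_le_mul' (Set.indicator_le_self' (fun _ _ => zero_le) z)
              (add_le_add le_rfl (mul_le_mul_right h1 _))
        _ = (1 - (β : ℝ≥0∞))⁻¹ := by rw [one_mul, h2]
    obtain ⟨T, hT, h⟩ := exists_transition_eq_upperTransition hne hc hD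
      fun z => ne_top_of_le_ne_top hC (hbound z)
    have h1 : H β ≤ hittingMap (β : ℝ≥0∞) A (transition T) (H β) := by
      conv_lhs => rw [show H β = leastSolution (β : ℝ≥0∞) A (upperTransition_mono D) from rfl,
        ← hittingMap_leastSolution]
      exact fun z => hittingMap_le_hittingMap le_rfl A (congrFun h z).ge
    have h2 := le_leastSolution_of_discount (hst T hT) hβ A hC hbound h1
    have h3 : leastSolution (β : ℝ≥0∞) A (transition_mono T) ≤ expectedHitting T A := by
      rw [expectedHitting_eq_leastSolution]
      refine leastSolution_le _ ?_
      conv_rhs => rw [← hittingMap_leastSolution]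
      exact fun z => hittingMap_le_hittingMap hβ.le A le_rfl
    exact (h2.trans h3 z).trans (le_iSup₂ (f := fun U _ => expectedHitting U A z) T hT)
  have hsup : (⨆ β : Set.Iio (1 : ℝ≥0∞), (β : ℝ≥0∞)) = 1 := by
    refine le_antisymm (iSup_le fun β => le_of_lt β.2) (le_of_forall_lt_imp_le_of_dense ?_)
    exact fun c hc => le_iSup (fun β : Set.Iio (1 : ℝ≥0∞) => (β : ℝ≥0∞)) ⟨c, hc⟩
  have hpre : leastSolution 1 A (upperTransition_mono D) ≤ fun z => ⨆ β, H β z := by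
    refine leastSolution_le _ fun z => ?_
    have htr : ∀ T ∈ D, transition T (fun z => ⨆ β, H β z) z ≤
        ⨆ β, upperTransition D (H β) z := by
      intro T hT
      have : transition T (fun z => ⨆ β, H β z) z = ⨆ β, transition T (H β) z := by
        simp only [transition, ENNReal.mul_iSup]
        rw [ENNReal.finsetSum_iSup_of_monotone]
        exact fun z' β γ h => mul_le_mul_right (hmono h z') _
      rw [this]
      exact iSup_mono fun β => le_iSup₂ (f := fun U _ => transition U (H β) z) T hT
    have hne' : Nonempty (Set.Iio (1 : ℝ≥0∞)) := ⟨⟨0, Set.mem_Iio.2 zero_lt_one⟩⟩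
    calc hittingMap 1 A (upperTransition D) (fun z => ⨆ β, H β z) z
        ≤ Aᶜ.indicator 1 z * (1 + (⨆ β : Set.Iio (1 : ℝ≥0∞), (β : ℝ≥0∞)) *
            ⨆ β, upperTransition D (H β) z) := by
          rw [hsup]
          exact mul_le_mul_right (add_le_add le_rfl (mul_le_mul_right (iSup₂_le htr) _)) _
      _ ≤ ⨆ β : Set.Iio (1 : ℝ≥0∞),
            Aᶜ.indicator 1 z * (1 + (β : ℝ≥0∞) * upperTransition D (H β) z) := by
          -- The two suprema merge into one by passing to the larger index, as `H` is monotone.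
          simp only [ENNReal.iSup_mul, ENNReal.mul_iSup, ENNReal.add_iSup]
          refine iSup₂_le fun β γ => le_iSup_of_le (max γ β) ?_
          refine mul_le_mul_right (add_le_add le_rfl (mul_le_mul' ?_ ?_)) _
          · exact_mod_cast le_max_left γ β
          · exact upperTransition_mono D (hmono (le_max_right γ β)) z
      _ = ⨆ β, H β z := iSup_congr fun β => congrFun (hittingMap_leastSolution _ A _) z
  exact (hpre z).trans (iSup_le fun β => hH β z)

end MinimalSolutions

/-! ### Transition operators of the convex hull. -/

section ConvexHull

variable {S : Type*} [Fintype S]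

theorem transition_convexComb {T U : Matrix S S ℝ} (hT : ∀ z z', 0 ≤ T z z')
    (hU : ∀ z z', 0 ≤ U z z') {a b : ℝ} (ha : 0 ≤ a) (hb : 0 ≤ b) (f : S → ℝ≥0∞) (z : S) :
    transition (a • T + b • U) f z =
      ENNReal.ofReal a * transition T f z + ENNReal.ofReal b * transition U f z := by
  simp only [transition, Finset.mul_sum, ← Finset.sum_add_distrib]
  refine Finset.sum_congr rfl fun z' _ => ?_
  rw [Matrix.add_apply, Matrix.smul_apply, Matrix.smul_apply, smul_eq_mul, smul_eq_mul,
    ENNReal.ofReal_add (mul_nonneg ha (hT z z')) (mul_nonneg hb (hU z z')),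
    ENNReal.ofReal_mul ha, ENNReal.ofReal_mul hb, add_mul, mul_assoc, mul_assoc]

theorem ofReal_mul_add_ofReal_mul {a b : ℝ} (ha : 0 ≤ a) (hb : 0 ≤ b) (hab : a + b = 1)
    (c : ℝ≥0∞) : ENNReal.ofReal a * c + ENNReal.ofReal b * c = c := by
  rw [← add_mul, ← ENNReal.ofReal_add ha hb, hab, ENNReal.ofReal_one, one_mul]

theorem convexHull_subset_rowStochastic [DecidableEq S] {D : Set (Matrix S S ℝ)}
    (hst : ∀ T ∈ D, T ∈ Matrix.rowStochastic ℝ S) :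
    ∀ T ∈ convexHull ℝ D, T ∈ Matrix.rowStochastic ℝ S :=
  fun _ hT => convexHull_min (t := (Matrix.rowStochastic ℝ S : Set (Matrix S S ℝ))) hst
    Matrix.convex_rowStochastic hT

theorem upperTransition_convexHull [DecidableEq S] {D : Set (Matrix S S ℝ)}
    (hst : ∀ T ∈ D, T ∈ Matrix.rowStochastic ℝ S) :
    upperTransition (convexHull ℝ D) = upperTransition D := by
  ext f z
  refine le_antisymm (iSup₂_le fun T hT => ?_) (biSup_mono fun T hT => subset_convexHull ℝ D hT)
  -- Nonnegativity is part of the set because `ENNReal.ofReal` is additive only on nonnegative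
  -- reals.
  have hconv : Convex ℝ {T : Matrix S S ℝ | (∀ z z', 0 ≤ T z z') ∧
      transition T f z ≤ upperTransition D f z} := by
    rintro T ⟨hT, hT'⟩ U ⟨hU, hU'⟩ a b ha hb hab
    refine ⟨fun z z' => add_nonneg (mul_nonneg ha (hT z z')) (mul_nonneg hb (hU z z')), ?_⟩
    rw [transition_convexComb hT hU ha hb,
      ← ofReal_mul_add_ofReal_mul ha hb hab (upperTransition D f z)]
    exact add_le_add (mul_le_mul_right hT' _) (mul_le_mul_right hU' _)
  refine (convexHull_min (fun U hU => ?_) hconv hT).2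
  exact ⟨fun z z' => Matrix.nonneg_of_mem_rowStochastic (hst U hU),
    le_iSup₂ (f := fun V _ => transition V f z) U hU⟩

theorem lowerTransition_convexHull [DecidableEq S] {D : Set (Matrix S S ℝ)}
    (hst : ∀ T ∈ D, T ∈ Matrix.rowStochastic ℝ S) :
    lowerTransition (convexHull ℝ D) = lowerTransition D := by
  ext f z
  refine le_antisymm (biInf_mono fun T hT => subset_convexHull ℝ D hT) (le_iInf₂ fun T hT => ?_)
  have hconv : Convex ℝ {T : Matrix S S ℝ | (∀ z z', 0 ≤ T z z') ∧
      lowerTransition D f z ≤ transition T f z} := by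
    rintro T ⟨hT, hT'⟩ U ⟨hU, hU'⟩ a b ha hb hab
    refine ⟨fun z z' => add_nonneg (mul_nonneg ha (hT z z')) (mul_nonneg hb (hU z z')), ?_⟩
    rw [transition_convexComb hT hU ha hb,
      ← ofReal_mul_add_ofReal_mul ha hb hab (lowerTransition D f z)]
    exact add_le_add (mul_le_mul_right hT' _) (mul_le_mul_right hU' _)
  refine (convexHull_min (fun U hU => ?_) hconv hT).2
  exact ⟨fun z z' => Matrix.nonneg_of_mem_rowStochastic (hst U hU),
    iInf₂_le (f := fun V _ => transition V f z) U hU⟩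

end ConvexHull

/-! ### Hitting times of imprecise Markov chains. -/

section ImpreciseHitting

variable {S : Type*} [Fintype S] [DecidableEq S] [MeasurableSpace S] [MeasurableSingletonClass S]
  {D : Set (Matrix S S ℝ)}

theorem upperHitting_eq_iSup (hst : ∀ T ∈ D, T ∈ Matrix.rowStochastic ℝ S) (A : Set S) (z : S) :
    upperHitting D A z = ⨆ T ∈ D, expectedHitting T A z := by
  refine le_antisymm (iSup₂_le fun P ⟨T, hT, hP⟩ => iSup_le fun hz => ?_)
    (iSup₂_le fun T hT => ?_)
  · rw [hP.expectationFrom_hittingTime A hz]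
    exact le_iSup₂ (f := fun U _ => expectedHitting U A z) T hT
  · obtain ⟨P, hP, hz⟩ := exists_isHomogeneousMarkovChain (hst T hT) z
    rw [← hP.expectationFrom_hittingTime A hz]
    exact le_iSup₂_of_le P ⟨T, hT, hP⟩
      (le_iSup (fun _ : P {ω | ω 0 = z} ≠ 0 => expectationFrom P (hittingTime A) z) hz)

theorem lowerHitting_eq_iInf (hst : ∀ T ∈ D, T ∈ Matrix.rowStochastic ℝ S) (A : Set S) (z : S) :
    lowerHitting D A z = ⨅ T ∈ D, expectedHitting T A z := by
  refine le_antisymm (le_iInf₂ fun T hT => ?_)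
    (le_iInf₂ fun P ⟨T, hT, hP⟩ => le_iInf fun hz => ?_)
  · obtain ⟨P, hP, hz⟩ := exists_isHomogeneousMarkovChain (hst T hT) z
    rw [← hP.expectationFrom_hittingTime A hz]
    exact iInf₂_le_of_le P ⟨T, hT, hP⟩
      (iInf_le (fun _ : P {ω | ω 0 = z} ≠ 0 => expectationFrom P (hittingTime A) z) hz)
  · rw [hP.expectationFrom_hittingTime A hz]
    exact iInf₂_le (f := fun U _ => expectedHitting U A z) T hT

theorem upperHitting_le_leastSolution (hst : ∀ T ∈ D, T ∈ Matrix.rowStochastic ℝ S) (A : Set S) :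
    upperHitting D A ≤ leastSolution 1 A (upperTransition_mono D) := by
  intro z
  rw [upperHitting_eq_iSup hst]
  refine iSup₂_le fun T hT => ?_
  rw [expectedHitting_eq_leastSolution]
  refine leastSolution_le (transition_mono T) (fun z => ?_) z
  conv_rhs => rw [← hittingMap_leastSolution]
  exact hittingMap_le_hittingMap le_rfl A (le_iSup₂ (f := fun U _ => transition U _ z) T hT)

theorem leastSolution_le_lowerHitting (hst : ∀ T ∈ D, T ∈ Matrix.rowStochastic ℝ S) (A : Set S) :
    leastSolution 1 A (lowerTransition_mono D) ≤ lowerHitting D A := by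
  intro z
  rw [lowerHitting_eq_iInf hst]
  refine le_iInf₂ fun T hT => ?_
  rw [expectedHitting_eq_leastSolution]
  refine leastSolution_le (lowerTransition_mono D) (fun z => ?_) z
  conv_rhs => rw [← hittingMap_leastSolution]
  exact hittingMap_le_hittingMap le_rfl A (iInf₂_le (f := fun U _ => transition U _ z) T hT)

theorem upperHitting_eq_leastSolution (hne : D.Nonempty)
    (hst : ∀ T ∈ D, T ∈ Matrix.rowStochastic ℝ S) (hc : IsCompact D) (hD : HasSSR D) (A : Set S) :
    upperHitting D A = leastSolution 1 A (upperTransition_mono D) := by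
  refine le_antisymm (upperHitting_le_leastSolution hst A) fun z => ?_
  rw [upperHitting_eq_iSup hst]
  exact leastSolution_upperTransition_le hne hst hc hD A z

/-- For a matrix minimising at the least lower solution, that solution solves the equation of the
single chain too, hence dominates its expected hitting time. -/
theorem lowerHitting_eq_leastSolution (hne : D.Nonempty)
    (hst : ∀ T ∈ D, T ∈ Matrix.rowStochastic ℝ S) (hc : IsCompact D) (hD : HasSSR D) (A : Set S) :
    lowerHitting D A = leastSolution 1 A (lowerTransition_mono D) := by
  refine le_antisymm (fun z => ?_) (leastSolution_le_lowerHitting hst A)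
  obtain ⟨T, hT, h⟩ := exists_transition_eq_lowerTransition hne hc hD
    (leastSolution 1 A (lowerTransition_mono D))
  rw [lowerHitting_eq_iInf hst]
  refine iInf₂_le_of_le T hT ?_
  rw [expectedHitting_eq_leastSolution]
  refine leastSolution_le (transition_mono T) (fun z => ?_) z
  conv_rhs => rw [← hittingMap_leastSolution]
  exact hittingMap_le_hittingMap le_rfl A (congrFun h z).le

/-- The hull is squeezed: enlarging the set can only raise the supremum, while the least solution
for the shared operator bounds it above. -/
theorem upperHitting_convexHull (hne : D.Nonempty)
    (hst : ∀ T ∈ D, T ∈ Matrix.rowStochastic ℝ S) (hc : IsCompact D) (hD : HasSSR D) (A : Set S) :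
    upperHitting (convexHull ℝ D) A = upperHitting D A := by
  have hst' := convexHull_subset_rowStochastic hst
  refine le_antisymm ?_ fun z => ?_
  · refine (upperHitting_le_leastSolution hst' A).trans ?_
    rw [upperHitting_eq_leastSolution hne hst hc hD]
    exact le_of_eq (leastSolution_congr _ _ (upperTransition_convexHull hst))
  · rw [upperHitting_eq_iSup hst, upperHitting_eq_iSup hst']
    exact biSup_mono fun T hT => subset_convexHull ℝ D hT

theorem lowerHitting_convexHull (hne : D.Nonempty)
    (hst : ∀ T ∈ D, T ∈ Matrix.rowStochastic ℝ S) (hc : IsCompact D) (hD : HasSSR D) (A : Set S) :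
    lowerHitting (convexHull ℝ D) A = lowerHitting D A := by
  have hst' := convexHull_subset_rowStochastic hst
  refine le_antisymm (fun z => ?_) ?_
  · rw [lowerHitting_eq_iInf hst, lowerHitting_eq_iInf hst']
    exact biInf_mono fun T hT => subset_convexHull ℝ D hT
  · refine le_trans ?_ (leastSolution_le_lowerHitting hst' A)
    rw [lowerHitting_eq_leastSolution hne hst hc hD]
    exact le_of_eq (leastSolution_congr _ _ (lowerTransition_convexHull hst).symm)

theorem isMinimalSolution_upperHitting (hne : D.Nonempty)
    (hst : ∀ T ∈ D, T ∈ Matrix.rowStochastic ℝ S) (hc : IsCompact D) (hD : HasSSR D) (A : Set S) :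
    IsMinimalSolution A (upperTransition (convexHull ℝ D)) (upperHitting D A) := by
  rw [upperTransition_convexHull hst, upperHitting_eq_leastSolution hne hst hc hD]
  exact isMinimalSolution_leastSolution A _

theorem isMinimalSolution_lowerHitting (hne : D.Nonempty)
    (hst : ∀ T ∈ D, T ∈ Matrix.rowStochastic ℝ S) (hc : IsCompact D) (hD : HasSSR D) (A : Set S) :
    IsMinimalSolution A (lowerTransition (convexHull ℝ D)) (lowerHitting D A) := by
  rw [lowerTransition_convexHull hst, lowerHitting_eq_leastSolution hne hst hc hD]
  exact isMinimalSolution_leastSolution A _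

end ImpreciseHitting

/-! ### Structure of the joint sets and of meeting times. -/

section JointSets

variable {Z : Type*} {𝒯 : Set (Matrix Z Z ℝ)}

theorem jointSet₂_nonempty (hne : 𝒯.Nonempty) : (jointSet₂ 𝒯).Nonempty :=
  hne.elim fun T hT => ⟨_, fun _ => T, fun _ => T, fun _ => hT, fun _ => hT, rfl⟩

theorem jointSet_nonempty (m : ℕ) (hne : 𝒯.Nonempty) : (jointSet m 𝒯).Nonempty :=
  hne.elim fun T hT => ⟨_, fun _ _ => T, fun _ _ => hT, rfl⟩

theorem jointSet₂_rowStochastic [Fintype Z] [DecidableEq Z]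
    (hst : ∀ T ∈ 𝒯, T ∈ Matrix.rowStochastic ℝ Z) :
    ∀ Δ ∈ jointSet₂ 𝒯, Δ ∈ Matrix.rowStochastic ℝ (Z × Z) := by
  rintro _ ⟨T, S, hT, hS, rfl⟩
  refine Matrix.mem_rowStochastic_iff_sum.2 ⟨fun p q => ?_, fun p => ?_⟩
  · exact mul_nonneg (Matrix.nonneg_of_mem_rowStochastic (hst _ (hT _)))
      (Matrix.nonneg_of_mem_rowStochastic (hst _ (hS _)))
  · simp only [jointMatrix₂, Matrix.of_apply, Fintype.sum_prod_type, ← Finset.mul_sum,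
      Matrix.sum_row_of_mem_rowStochastic (hst _ (hS _)),
      Matrix.sum_row_of_mem_rowStochastic (hst _ (hT _)), mul_one]

theorem jointMatrix_apply {m : ℕ}
    (T : (j : Fin m) → ({i : Fin m // i ≠ j} → Z) → Matrix Z Z ℝ) (z z' : Fin m → Z) :
    jointMatrix T z z' = ∏ j, T j (fun i => z i) (z j) (z' j) :=
  rfl

theorem jointSet_rowStochastic [Fintype Z] [DecidableEq Z] (m : ℕ)
    (hst : ∀ T ∈ 𝒯, T ∈ Matrix.rowStochastic ℝ Z) :
    ∀ Δ ∈ jointSet m 𝒯, Δ ∈ Matrix.rowStochastic ℝ (Fin m → Z) := by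
  rintro _ ⟨T, hT, rfl⟩
  refine Matrix.mem_rowStochastic_iff_sum.2 ⟨fun p q => ?_, fun p => ?_⟩
  · rw [jointMatrix_apply]
    exact Finset.prod_nonneg fun j _ => Matrix.nonneg_of_mem_rowStochastic (hst _ (hT _ _))
  · simp only [jointMatrix, Matrix.of_apply]
    have := Finset.prod_univ_sum (fun _ : Fin m => (Finset.univ : Finset Z))
      (fun j z' => T j (fun i => p i) (p j) z')
    rw [Fintype.piFinset_univ] at this
    rw [← this]
    exact Finset.prod_eq_one fun j _ => Matrix.sum_row_of_mem_rowStochastic (hst _ (hT _ _)) _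

theorem isCompact_jointSet₂ (hc : IsCompact 𝒯) : IsCompact (jointSet₂ 𝒯) := by
  have h : jointSet₂ 𝒯 = (fun p : (Z → Matrix Z Z ℝ) × (Z → Matrix Z Z ℝ) =>
      jointMatrix₂ p.1 p.2) '' ((Set.univ.pi fun _ => 𝒯) ×ˢ (Set.univ.pi fun _ => 𝒯)) := by
    ext Δ
    constructor
    · rintro ⟨T, S, hT, hS, rfl⟩
      exact ⟨(T, S), ⟨fun y _ => hT y, fun x _ => hS x⟩, rfl⟩
    · rintro ⟨⟨T, S⟩, ⟨hT, hS⟩, rfl⟩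
      exact ⟨T, S, fun y => hT y trivial, fun x => hS x trivial, rfl⟩
  rw [h]
  refine ((isCompact_univ_pi fun _ => hc).prod (isCompact_univ_pi fun _ => hc)).image ?_
  refine continuous_matrix fun p q => ?_
  simp only [jointMatrix₂, Matrix.of_apply]
  exact (((continuous_apply p.2).comp continuous_fst).matrix_elem _ _).mul
    (((continuous_apply p.1).comp continuous_snd).matrix_elem _ _)

theorem isCompact_jointSet (m : ℕ) (hc : IsCompact 𝒯) : IsCompact (jointSet m 𝒯) := by
  have h : jointSet m 𝒯 = jointMatrix ''
      (Set.univ.pi fun _ : Fin m => Set.univ.pi fun _ => 𝒯) := by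
    ext Δ
    constructor
    · rintro ⟨T, hT, rfl⟩
      exact ⟨T, fun j _ w _ => hT j w, rfl⟩
    · rintro ⟨T, hT, rfl⟩
      exact ⟨T, fun j w => hT j trivial w trivial, rfl⟩
  rw [h]
  refine (isCompact_univ_pi fun _ => isCompact_univ_pi fun _ => hc).image ?_
  refine continuous_matrix fun p q => ?_
  simp only [jointMatrix, Matrix.of_apply]
  exact continuous_finsetProd _ fun j _ =>
    ((continuous_apply _).comp (continuous_apply j)).matrix_elem _ _

theorem hasSSR_jointSet₂ (hD : HasSSR 𝒯) : HasSSR (jointSet₂ 𝒯) := by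
  intro Δ hΔ
  choose U hU hrow using hΔ
  choose T S hT hS hTS using hU
  -- Joint row `(x, y)` uses only row `x` of `T y` and row `y` of `S x`, so SSR of `𝒯` lets these be
  -- chosen separately for each pair.
  choose T' hT' hTrow using fun y => hD.exists_forall
    (p := fun x r => r = T (x, y) y x) fun x => ⟨T (x, y) y, hT _ _, rfl⟩
  choose S' hS' hSrow using fun x => hD.exists_forall
    (p := fun y r => r = S (x, y) x y) fun y => ⟨S (x, y) x, hS _ _, rfl⟩
  refine ⟨T', S', hT', hS', ?_⟩
  ext p q
  rw [← hrow p, hTS p]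
  simp only [jointMatrix₂, Matrix.of_apply, hTrow, hSrow]

theorem hasSSR_jointSet (m : ℕ) (hD : HasSSR 𝒯) : HasSSR (jointSet m 𝒯) := by
  intro Δ hΔ
  choose U hU hrow using hΔ
  choose T hT hTU using hU
  -- `e j w x` reassembles the joint state from agent `j`'s state `x` and the others' states `w`,
  -- and so tells which joint row is served by row `x` of the matrix for `j` and `w`.
  let e : (j : Fin m) → ({i : Fin m // i ≠ j} → Z) → Z → Fin m → Z :=
    fun j w x i => if h : i = j then x else w ⟨i, h⟩
  have he : ∀ (j : Fin m) (z : Fin m → Z), e j (fun i => z i) (z j) = z := by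
    intro j z
    ext i
    by_cases h : i = j <;> simp [e, h]
  choose T' hT' hTrow using fun j w => hD.exists_forall
    (p := fun x r => r = T (e j w x) j w x) fun x => ⟨T (e j w x) j w, hT _ _ _, rfl⟩
  refine ⟨T', hT', ?_⟩
  ext p q
  rw [← hrow p, hTU p]
  simp only [jointMatrix, Matrix.of_apply, hTrow, he]

theorem meetingTime₂_eq_hittingTime :
    (meetingTime₂ : (ℕ → Z × Z) → ℝ≥0∞) = hittingTime (Set.diagonal Z) := by
  ext ω
  simp only [meetingTime₂, hittingTime, Set.mem_diagonal_iff]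

/-- Positivity of `m` supplies a coordinate to serve as the common state. -/
theorem meetingTime_eq_hittingTime {m : ℕ} (hm : 0 < m) :
    (meetingTime : (ℕ → Fin m → Z) → ℝ≥0∞) = hittingTime (multiDiagonal m Z) := by
  ext ω
  have h : ∀ n, (∀ i j, ω n i = ω n j) ↔ ω n ∈ multiDiagonal m Z := fun n =>
    ⟨fun h => ⟨ω n ⟨0, hm⟩, funext fun i => h i _⟩, by
      rintro ⟨k, hk⟩ i j
      rw [hk]⟩
  simp only [meetingTime, hittingTime, h]

end JointSets

/-! ### Failure of convexity. -/

section NonConvexity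

variable {Z : Type*} [Fintype Z] [DecidableEq Z]

/-- The transition matrix of the chain that jumps to `a` from every state. -/
def jumpTo (a : Z) : Matrix Z Z ℝ :=
  Matrix.of fun _ z' => if z' = a then 1 else 0

theorem jumpTo_mem_rowStochastic (a : Z) : jumpTo a ∈ Matrix.rowStochastic ℝ Z := by
  refine Matrix.mem_rowStochastic_iff_sum.2 ⟨fun _ z' => ?_, fun _ => by simp [jumpTo]⟩
  simp only [jumpTo, Matrix.of_apply]
  split_ifs <;> norm_num

theorem isCompact_rowStochastic :
    IsCompact (Matrix.rowStochastic ℝ Z : Set (Matrix Z Z ℝ)) := by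
  have h : (Matrix.rowStochastic ℝ Z : Set (Matrix Z Z ℝ)) =
      Set.univ.pi fun _ : Z => stdSimplex ℝ Z := by
    ext T
    rw [SetLike.mem_coe, Matrix.mem_rowStochastic_iff_sum]
    exact ⟨fun h z _ => ⟨h.1 z, h.2 z⟩, fun h =>
      ⟨fun z => (h z trivial).1, fun z => (h z trivial).2⟩⟩
  rw [h]
  exact isCompact_univ_pi fun _ => isCompact_stdSimplex ℝ Z

theorem hasSSR_rowStochastic : HasSSR (Matrix.rowStochastic ℝ Z : Set (Matrix Z Z ℝ)) := by
  intro T hT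
  refine Matrix.mem_rowStochastic_iff_sum.2 ⟨fun z z' => ?_, fun z => ?_⟩
  all_goals
    obtain ⟨U, hU, h⟩ := hT z
    rw [← h]
  · exact Matrix.nonneg_of_mem_rowStochastic hU
  · exact Matrix.sum_row_of_mem_rowStochastic hU z

/-- The midpoint of "both jump to `a`" and "both jump to `b`" puts mass only on `(a, a)` and `(b,
b)`. A product row charging both would also charge `(a, b)`. -/
theorem not_convex_jointSet₂_rowStochastic {a b : Z} (hab : a ≠ b) :
    ¬ Convex ℝ (jointSet₂ (Matrix.rowStochastic ℝ Z : Set (Matrix Z Z ℝ))) := by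
  intro hconv
  have hJ : ∀ c : Z, jointMatrix₂ (fun _ => jumpTo c) (fun _ => jumpTo c) ∈
      jointSet₂ (Matrix.rowStochastic ℝ Z : Set (Matrix Z Z ℝ)) := fun c =>
    ⟨_, _, fun _ => jumpTo_mem_rowStochastic c, fun _ => jumpTo_mem_rowStochastic c, rfl⟩
  obtain ⟨T, S, -, -, h⟩ := hconv (hJ a) (hJ b) (a := 1 / 2) (b := 1 / 2)
    (by norm_num) (by norm_num) (by norm_num)
  have haa := congrFun (congrFun h (a, a)) (a, a)
  have hbb := congrFun (congrFun h (a, a)) (b, b)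
  have hm := congrFun (congrFun h (a, a)) (a, b)
  simp [jointMatrix₂, jumpTo, hab, hab.symm] at haa hbb hm
  rcases hm with hm | hm
  · simp [hm] at haa
  · simp [hm] at hbb

theorem not_convex_jointSet_rowStochastic {a b : Z} (hab : a ≠ b) {m : ℕ} (hm : 2 ≤ m) :
    ¬ Convex ℝ (jointSet m (Matrix.rowStochastic ℝ Z : Set (Matrix Z Z ℝ))) := by
  intro hconv
  have hJ : ∀ c : Z, jointMatrix (m := m) (fun _ _ => jumpTo c) ∈
      jointSet m (Matrix.rowStochastic ℝ Z : Set (Matrix Z Z ℝ)) := fun c =>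
    ⟨_, fun _ _ => jumpTo_mem_rowStochastic c, rfl⟩
  obtain ⟨T, -, h⟩ := hconv (hJ a) (hJ b) (a := 1 / 2) (b := 1 / 2)
    (by norm_num) (by norm_num) (by norm_num)
  have hval : ∀ c : Z, ∀ q : Fin m → Z, (∃ j, q j ≠ c) →
      jointMatrix (fun _ _ => jumpTo c) (fun _ => a) q = 0 := by
    rintro c q ⟨j, hj⟩
    exact Finset.prod_eq_zero (Finset.mem_univ j) (by simp [jumpTo, hj])
  have hone : ∀ c : Z, jointMatrix (m := m) (fun _ _ => jumpTo c) (fun _ => a) (fun _ => c) = 1 :=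
    fun c => by simp [jointMatrix, jumpTo]
  let i₀ : Fin m := ⟨0, by omega⟩
  let i₁ : Fin m := ⟨1, by omega⟩
  have hi : i₁ ≠ i₀ := by simp [i₀, i₁]
  -- A mixed target, with agent `i₀` at `b` and the others at `a`. The midpoint gives it mass `0`,
  -- since `m ≥ 2` leaves an agent at `a`, yet each of its factors is nonzero by the constant
  -- targets.
  let q : Fin m → Z := Function.update (fun _ => a) i₀ b
  have hq₀ : q i₀ = b := Function.update_self _ _ _
  have hq₁ : q i₁ = a := Function.update_of_ne hi _ _
  have haa := congrFun (congrFun h fun _ => a) fun _ => a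
  have hbb := congrFun (congrFun h fun _ => a) fun _ => b
  have hmix := congrFun (congrFun h fun _ => a) q
  rw [Matrix.add_apply, Matrix.smul_apply, Matrix.smul_apply] at haa hbb hmix
  rw [hone, hval b _ ⟨i₀, hab⟩] at haa
  rw [hone, hval a _ ⟨i₀, hab.symm⟩] at hbb
  rw [hval a q ⟨i₀, by rw [hq₀]; exact hab.symm⟩, hval b q ⟨i₁, by rw [hq₁]; exact hab⟩] at hmix
  have hne : ∀ c : Z, jointMatrix T (fun _ => a) (fun _ => c) ≠ 0 →
      ∀ j, T j (fun _ => a) a c ≠ 0 := fun c hc j => by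
    rw [jointMatrix_apply] at hc
    exact Finset.prod_ne_zero_iff.1 hc j (Finset.mem_univ j)
  have ha := hne a (by rw [← haa]; norm_num)
  have hb := hne b (by rw [← hbb]; norm_num)
  have hmix' : jointMatrix T (fun _ => a) q ≠ 0 := by
    rw [jointMatrix_apply]
    refine Finset.prod_ne_zero_iff.2 fun j _ => ?_
    by_cases hj : j = i₀
    · rw [hj, hq₀]
      exact hb i₀
    · rw [show q j = a from Function.update_of_ne hj _ _]
      exact ha j
  exact hmix' (by rw [← hmix]; norm_num)

end NonConvexity

end MeetingTimes

end

theorem mainTheorem2 {Z : Type*} [Fintype Z] [DecidableEq Z] [MeasurableSpace Z]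
    [MeasurableSingletonClass Z] (hZ : 2 ≤ Fintype.card Z) :
    -- two agents and `m` agents, for every admissible set of allowed actions
    (∀ 𝒯 : Set (Matrix Z Z ℝ), 𝒯.Nonempty → (∀ T ∈ 𝒯, T ∈ Matrix.rowStochastic ℝ Z) →
      IsCompact 𝒯 → MeetingTimes.HasSSR 𝒯 →
      ((∀ Δ ∈ MeetingTimes.jointSet₂ 𝒯, Δ ∈ Matrix.rowStochastic ℝ (Z × Z)) ∧
        IsCompact (MeetingTimes.jointSet₂ 𝒯) ∧
        MeetingTimes.HasSSR (MeetingTimes.jointSet₂ 𝒯) ∧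
        MeetingTimes.upperMeeting₂ (MeetingTimes.jointSet₂ 𝒯) =
          MeetingTimes.upperHitting (MeetingTimes.jointSet₂ 𝒯) (Set.diagonal Z) ∧
        MeetingTimes.upperMeeting₂ (convexHull ℝ (MeetingTimes.jointSet₂ 𝒯)) =
          MeetingTimes.upperMeeting₂ (MeetingTimes.jointSet₂ 𝒯) ∧
        MeetingTimes.IsMinimalSolution (Set.diagonal Z)
          (MeetingTimes.upperTransition (convexHull ℝ (MeetingTimes.jointSet₂ 𝒯)))
          (MeetingTimes.upperMeeting₂ (MeetingTimes.jointSet₂ 𝒯)) ∧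
        MeetingTimes.lowerMeeting₂ (MeetingTimes.jointSet₂ 𝒯) =
          MeetingTimes.lowerHitting (MeetingTimes.jointSet₂ 𝒯) (Set.diagonal Z) ∧
        MeetingTimes.lowerMeeting₂ (convexHull ℝ (MeetingTimes.jointSet₂ 𝒯)) =
          MeetingTimes.lowerMeeting₂ (MeetingTimes.jointSet₂ 𝒯) ∧
        MeetingTimes.IsMinimalSolution (Set.diagonal Z)
          (MeetingTimes.lowerTransition (convexHull ℝ (MeetingTimes.jointSet₂ 𝒯)))
          (MeetingTimes.lowerMeeting₂ (MeetingTimes.jointSet₂ 𝒯))) ∧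
      (∀ m : ℕ, 2 ≤ m →
        (∀ Δ ∈ MeetingTimes.jointSet m 𝒯, Δ ∈ Matrix.rowStochastic ℝ (Fin m → Z)) ∧
        IsCompact (MeetingTimes.jointSet m 𝒯) ∧
        MeetingTimes.HasSSR (MeetingTimes.jointSet m 𝒯) ∧
        MeetingTimes.upperMeeting (MeetingTimes.jointSet m 𝒯) =
          MeetingTimes.upperHitting (MeetingTimes.jointSet m 𝒯)
            (MeetingTimes.multiDiagonal m Z) ∧
        MeetingTimes.upperMeeting (convexHull ℝ (MeetingTimes.jointSet m 𝒯)) =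
          MeetingTimes.upperMeeting (MeetingTimes.jointSet m 𝒯) ∧
        MeetingTimes.IsMinimalSolution (MeetingTimes.multiDiagonal m Z)
          (MeetingTimes.upperTransition (convexHull ℝ (MeetingTimes.jointSet m 𝒯)))
          (MeetingTimes.upperMeeting (MeetingTimes.jointSet m 𝒯)) ∧
        MeetingTimes.lowerMeeting (MeetingTimes.jointSet m 𝒯) =
          MeetingTimes.lowerHitting (MeetingTimes.jointSet m 𝒯)
            (MeetingTimes.multiDiagonal m Z) ∧
        MeetingTimes.lowerMeeting (convexHull ℝ (MeetingTimes.jointSet m 𝒯)) =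
          MeetingTimes.lowerMeeting (MeetingTimes.jointSet m 𝒯) ∧
        MeetingTimes.IsMinimalSolution (MeetingTimes.multiDiagonal m Z)
          (MeetingTimes.lowerTransition (convexHull ℝ (MeetingTimes.jointSet m 𝒯)))
          (MeetingTimes.lowerMeeting (MeetingTimes.jointSet m 𝒯)))) ∧
    -- convexity is lost in general, even for convex sets of allowed actions
    (∃ 𝒯 : Set (Matrix Z Z ℝ), 𝒯.Nonempty ∧ (∀ T ∈ 𝒯, T ∈ Matrix.rowStochastic ℝ Z) ∧
      IsCompact 𝒯 ∧ Convex ℝ 𝒯 ∧ MeetingTimes.HasSSR 𝒯 ∧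
      ¬ Convex ℝ (MeetingTimes.jointSet₂ 𝒯) ∧
      ∀ m : ℕ, 2 ≤ m → ¬ Convex ℝ (MeetingTimes.jointSet m 𝒯)) := by
  refine ⟨fun 𝒯 hne hst hc hD => ⟨?_, fun m hm => ?_⟩, ?_⟩
  · have hne' := MeetingTimes.jointSet₂_nonempty hne
    have hst' := MeetingTimes.jointSet₂_rowStochastic hst
    have hc' := MeetingTimes.isCompact_jointSet₂ hc
    have hD' := MeetingTimes.hasSSR_jointSet₂ hD
    have hu : ∀ D : Set (Matrix (Z × Z) (Z × Z) ℝ), MeetingTimes.upperMeeting₂ D =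
        MeetingTimes.upperHitting D (Set.diagonal Z) := fun D => by
      rw [MeetingTimes.upperMeeting₂, MeetingTimes.meetingTime₂_eq_hittingTime]
      rfl
    have hl : ∀ D : Set (Matrix (Z × Z) (Z × Z) ℝ), MeetingTimes.lowerMeeting₂ D =
        MeetingTimes.lowerHitting D (Set.diagonal Z) := fun D => by
      rw [MeetingTimes.lowerMeeting₂, MeetingTimes.meetingTime₂_eq_hittingTime]
      rfl
    simp only [hu, hl]
    exact ⟨hst', hc', hD', trivial, MeetingTimes.upperHitting_convexHull hne' hst' hc' hD' _,
      MeetingTimes.isMinimalSolution_upperHitting hne' hst' hc' hD' _, trivial,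
      MeetingTimes.lowerHitting_convexHull hne' hst' hc' hD' _,
      MeetingTimes.isMinimalSolution_lowerHitting hne' hst' hc' hD' _⟩
  · have hne' := MeetingTimes.jointSet_nonempty m hne
    have hst' := MeetingTimes.jointSet_rowStochastic m hst
    have hc' := MeetingTimes.isCompact_jointSet m hc
    have hD' := MeetingTimes.hasSSR_jointSet m hD
    have hu : ∀ D : Set (Matrix (Fin m → Z) (Fin m → Z) ℝ), MeetingTimes.upperMeeting D =
        MeetingTimes.upperHitting D (MeetingTimes.multiDiagonal m Z) := fun D => by
      rw [MeetingTimes.upperMeeting, MeetingTimes.meetingTime_eq_hittingTime (by omega)]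
      rfl
    have hl : ∀ D : Set (Matrix (Fin m → Z) (Fin m → Z) ℝ), MeetingTimes.lowerMeeting D =
        MeetingTimes.lowerHitting D (MeetingTimes.multiDiagonal m Z) := fun D => by
      rw [MeetingTimes.lowerMeeting, MeetingTimes.meetingTime_eq_hittingTime (by omega)]
      rfl
    simp only [hu, hl]
    exact ⟨hst', hc', hD', trivial, MeetingTimes.upperHitting_convexHull hne' hst' hc' hD' _,
      MeetingTimes.isMinimalSolution_upperHitting hne' hst' hc' hD' _, trivial,
      MeetingTimes.lowerHitting_convexHull hne' hst' hc' hD' _,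
      MeetingTimes.isMinimalSolution_lowerHitting hne' hst' hc' hD' _⟩
  -- The set of all stochastic matrices is a counterexample for every number of agents at once.
  · obtain ⟨a, b, hab⟩ := Fintype.one_lt_card_iff.1 (lt_of_lt_of_le one_lt_two hZ)
    exact ⟨Matrix.rowStochastic ℝ Z, ⟨1, one_mem _⟩, fun T hT => hT,
      MeetingTimes.isCompact_rowStochastic, Matrix.convex_rowStochastic,
      MeetingTimes.hasSSR_rowStochastic, MeetingTimes.not_convex_jointSet₂_rowStochastic hab,
      fun m hm => MeetingTimes.not_convex_jointSet_rowStochastic hab hm⟩
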